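/- Let $p\in\{2,3,5,7,11\}$, let $F$ be a field of characteristic $p$, and let $A=(a_{ij})_{i,j=1}^{3}$ be the matrix whose nine entries are independent indeterminates over $F$; put $K=F(a_{11},\dots,a_{33})$. Matrices act on row vectors from the right. Let $C=\{0,\dots,p-1\}^3$ with the componentwise partial order. To each line parallel to a coordinate axis through a point of $C$ attach a copy of the one-dimensional space $K$, and let $\mathbf V_i\cong K^{p^2}$ ($i=1,2,3$) be the direct sum of the copies belonging to the lines parallel to the $i$-th axis. For $x\in C$ let $A^{(x)}$ act on $\mathbf V_1\oplus\mathbf V_2\oplus\mathbf V_3$ as $A$ on the three copies of $K$ belonging to the three lines through $x$ (the $i$-th copy being the one on the line parallel to the $i$-th axis), and as the identity on the other copies. Let $R=\prod_{x\in C}A^{(x)}$ be the $p\times p\times p$ block, where the product is taken in any order in which $A^{(x)}$ stands before (to the left of) $A^{(y)}$ whenever $x<y$; the result does not depend on the choice of such an order. Write $R=(R_{ij})_{i,j=1}^3$, where the $p^2\times p^2$ matrix $R_{ij}$ maps $\mathbf V_i$ to $\mathbf V_j$. Then: 1. $R_{ii}=a_{ii}^p\cdot\mathbb 1$ for $i=1,2,3$.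 2. $R_{kl}R_{lk}=R_{lk}R_{kl}=a_{kl}^p a_{lk}^p\cdot\mathbb 1$ for $1\le k<l\le 3$. 3. $R_{12}R_{23}R_{31}$ is diagonalizable over $K$, with eigenvalue $a_{13}^p a_{32}^p a_{21}^p$ of multiplicity $\frac{p(p-1)}2$ and eigenvalue $a_{12}^p a_{23}^p a_{31}^p$ of multiplicity $\frac{p(p+1)}2$. 4. Let $\mathsf r=(a_{ij}^p)_{i,j=1}^3$. By choosing a proper basis in each of $\mathbf V_1,\mathbf V_2,\mathbf V_3$, that is, by a gauge transformation $R\mapsto G^{-1}RG$ with $G=\mathrm{diag}(g_1,g_2,g_3)$ and $g_i\in \mathrm{GL}_{p^2}(K)$, one brings $R$ to the direct sum of $\frac{p(p-1)}2$ copies of $\mathsf r^{\mathrm T}$ and $\frac{p(p+1)}2$ copies of $\mathsf r$. In each copy, the three basis vectors lie in $\mathbf V_1,\mathbf V_2,\mathbf V_3$ respectively. -/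

import Mathlib

/-!
Vectors are rows and matrices act on them from the right, so the leftmost factor of a product
of matrices acts first.

The lattice cube with `l` points along each edge in dimension `d = n + 1` is
`Fin (n + 1) → Fin l`, with the componentwise (partial) order. The straight line through a
lattice point `x` parallel to the `i`-th axis is recorded by the axis `i` together with the
remaining coordinates `i.removeNth x : Fin n → Fin l` of `x`. Each line carries one copy of the
one-dimensional space `K`; hence row vectors of the block are indexed by
`Fin (n + 1) × (Fin n → Fin l)`, and the `i`-th thick space has the basis `Fin n → Fin l`.
-/

/-- The copy of the brick `A` at the lattice point `x`: it acts as `A` on the copies of `K`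
carried by the lines that pass through `x`, and as the identity on all other copies. -/
def brickAt {K : Type*} [CommRing K] {n l : ℕ} (A : Matrix (Fin (n + 1)) (Fin (n + 1)) K)
    (x : Fin (n + 1) → Fin l) :
    Matrix (Fin (n + 1) × (Fin n → Fin l)) (Fin (n + 1) × (Fin n → Fin l)) K :=
  Matrix.of fun u v =>
    if u.2 = u.1.removeNth x ∧ v.2 = v.1.removeNth x then A u.1 v.1
    else if u = v then 1 else 0

/-- A list that contains every point of the lattice cube exactly once and agrees with the
partial order: if `x < y` (componentwise), then `x` stands before `y`. -/
def IsAdmissibleOrder {n l : ℕ} (L : List (Fin (n + 1) → Fin l)) : Prop :=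
  L.Nodup ∧ (∀ x, x ∈ L) ∧ L.Pairwise fun x y => ¬ y < x

/-- The points of the lattice cube in lexicographic order. -/
noncomputable def lexOrder (n l : ℕ) : List (Fin (n + 1) → Fin l) :=
  ((Finset.univ : Finset (Lex (Fin (n + 1) → Fin l))).sort (· ≤ ·)).map ofLex

/-- The cubic `l × ⋯ × l` block of bricks `A`: the product of all copies of `A`, in an order
that agrees with the partial order of the lattice points. The lexicographic order is used;
every admissible order gives the same product, see `cubicBlock_eq`. -/
noncomputable def cubicBlock {K : Type*} [CommRing K] {n : ℕ} (l : ℕ)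
    (A : Matrix (Fin (n + 1)) (Fin (n + 1)) K) :
    Matrix (Fin (n + 1) × (Fin n → Fin l)) (Fin (n + 1) × (Fin n → Fin l)) K :=
  ((lexOrder n l).map (brickAt A)).prod

theorem lexOrder_isAdmissible (n l : ℕ) : IsAdmissibleOrder (lexOrder n l) := by
  refine ⟨?_, ?_, ?_⟩
  · exact (Finset.sort_nodup _ _).map ofLex.injective
  · intro x
    exact List.mem_map.2 ⟨toLex x, by simp, rfl⟩
  · refine List.pairwise_map.2 ((Finset.pairwise_sort _ _).imp ?_)
    intro a b hab hlt
    exact absurd (Pi.toLex_strictMono hlt) (not_lt.2 hab)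

theorem brickAt_commute {K : Type*} [CommRing K] {n l : ℕ}
    (A : Matrix (Fin (n + 1)) (Fin (n + 1)) K) (x y : Fin (n + 1) → Fin l)
    (hxy : ¬ x ≤ y) (hyx : ¬ y ≤ x) : Commute (brickAt A x) (brickAt A y) := by
  have key : ∀ i : Fin (n + 1), i.removeNth x ≠ i.removeNth y := by
    intro i h
    have hj : ∀ j, j ≠ i → x j = y j := by
      intro j hj
      obtain ⟨k, rfl⟩ := Fin.exists_succAbove_eq hj
      exact congrFun h k
    rcases le_total (x i) (y i) with hle | hle
    · refine hxy fun j => ?_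
      by_cases e : j = i
      · subst e; exact hle
      · exact (hj j e).le
    · refine hyx fun j => ?_
      by_cases e : j = i
      · subst e; exact hle
      · exact (hj j e).ge
  let E : (Fin (n + 1) → Fin l) →
      Matrix (Fin (n + 1) × (Fin n → Fin l)) (Fin (n + 1) × (Fin n → Fin l)) K := fun z =>
    Matrix.of fun u v =>
      if u.2 = u.1.removeNth z ∧ v.2 = v.1.removeNth z then
        A u.1 v.1 - (if u = v then 1 else 0) else 0
  have hE : ∀ z, brickAt A z = 1 + E z := by
    intro z
    ext u v
    by_cases h : u.2 = u.1.removeNth z ∧ v.2 = v.1.removeNth z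
    · simp [brickAt, E, h, Matrix.one_apply]
    · simp [brickAt, E, h, Matrix.one_apply]
  have h0 : ∀ z w : Fin (n + 1) → Fin l, (∀ i : Fin (n + 1), i.removeNth z ≠ i.removeNth w) →
      E z * E w = 0 := by
    intro z w hzw
    ext u v
    rw [Matrix.mul_apply]
    refine Finset.sum_eq_zero fun t _ => ?_
    by_cases ht : t.2 = t.1.removeNth z
    · have : ¬ (t.2 = t.1.removeNth w ∧ v.2 = v.1.removeNth w) :=
        fun h => hzw t.1 (ht.symm.trans h.1)
      simp [E, this]
    · have : ¬ (u.2 = u.1.removeNth z ∧ t.2 = t.1.removeNth z) := fun h => ht h.2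
      simp [E, this]
  have h1 := h0 x y key
  have h2 := h0 y x fun i => (key i).symm
  rw [hE, hE, commute_iff_eq]
  simp only [add_mul, mul_add, h1, h2, one_mul, mul_one, add_zero]
  abel

/-- The block does not depend on the choice of the admissible order. -/
theorem cubicBlock_eq {K : Type*} [CommRing K] {n l : ℕ}
    (A : Matrix (Fin (n + 1)) (Fin (n + 1)) K) (L : List (Fin (n + 1) → Fin l))
    (hL : IsAdmissibleOrder L) : cubicBlock l A = (L.map (brickAt A)).prod := by
  have main : ∀ L₁ L₂ : List (Fin (n + 1) → Fin l), L₁.Perm L₂ → L₁.Nodup →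
      L₁.Pairwise (fun x y => ¬ y < x) → L₂.Pairwise (fun x y => ¬ y < x) →
      (L₁.map (brickAt A)).prod = (L₂.map (brickAt A)).prod := by
    intro L₁
    induction L₁ with
    | nil => intro L₂ h _ _ _; rw [h.nil_eq]
    | cons x L ih =>
      intro L₂ h hn h1 h2
      obtain ⟨s, t, rfl⟩ := List.append_of_mem (h.subset (List.mem_cons_self (a := x)))
      have hp : L.Perm (s ++ t) :=
        (List.perm_cons x).1 (h.trans List.perm_middle)
      rw [List.nodup_cons] at hn
      rw [List.pairwise_cons] at h1
      have hst : (s ++ t).Pairwise (fun x y => ¬ y < x) :=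
        h2.sublist (List.Sublist.append_left (List.sublist_cons_self x t) s)
      have hc : Commute (brickAt A x) (s.map (brickAt A)).prod := by
        refine Commute.list_prod_right _ _ fun b hb => ?_
        obtain ⟨y, hy, rfl⟩ := List.mem_map.1 hb
        have hyL : y ∈ L := hp.symm.subset (List.mem_append_left t hy)
        have hne : x ≠ y := fun e => hn.1 (e ▸ hyL)
        have ha : ¬ y < x := h1.1 y hyL
        have hb : ¬ x < y := (List.pairwise_append.1 h2).2.2 y hy x List.mem_cons_self
        exact brickAt_commute A x y (fun h => hb (lt_of_le_of_ne h hne))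
          (fun h => ha (lt_of_le_of_ne h hne.symm))
      rw [List.map_cons, List.prod_cons, ih (s ++ t) hp hn.2 h1.2 hst]
      simp only [List.map_append, List.map_cons, List.prod_append, List.prod_cons]
      rw [← mul_assoc, hc.eq, mul_assoc]
  obtain ⟨a1, a2, a3⟩ := lexOrder_isAdmissible n l
  obtain ⟨b1, b2, b3⟩ := hL
  refine main _ _ ?_ a1 a3 b3
  exact (List.perm_ext_iff_of_nodup a1 b1).2 fun x => by simp [a2 x, b2 x]

/-- The block `R_ij` of a matrix, acting from the `i`-th thick space into the `j`-th one. -/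
def thickEntry {K : Type*} {d S : Type*} (R : Matrix (d × S) (d × S) K) (i j : d) :
    Matrix S S K :=
  Matrix.of fun s t => R (i, s) (j, t)

/-- The block-diagonal matrix with the diagonal blocks `g i`, acting in the `i`-th thick
space. -/
def gaugeMatrix {K : Type*} [CommRing K] {d S : Type*} [DecidableEq d]
    (g : d → Matrix S S K) : Matrix (d × S) (d × S) K :=
  (Matrix.blockDiagonal g).submatrix Prod.swap Prod.swap

/-- `R'` is obtained from `R` by a gauge transformation `R ↦ G⁻¹ R G`, where `G` is
block-diagonal with invertible blocks `g i`: that is, by a choice of a basis in each thick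
space. -/
def GaugeEquivalent {K : Type*} [CommRing K] {d S : Type*} [Fintype d] [DecidableEq d]
    [Fintype S] [DecidableEq S] (R R' : Matrix (d × S) (d × S) K) : Prop :=
  ∃ g : d → (Matrix S S K)ˣ,
    R' = gaugeMatrix (fun i => ((g i)⁻¹ : (Matrix S S K)ˣ).val) * R *
      gaugeMatrix (fun i => (g i).val)

/-- The `3 × 3` brick whose entries are independent indeterminates over `F`, as a matrix over
the field of rational functions in these indeterminates. -/
noncomputable def genericBrick (F : Type*) [Field F] :
    Matrix (Fin 3) (Fin 3) (FractionRing (MvPolynomial (Fin 3 × Fin 3) F)) :=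
  (Matrix.mvPolynomialX (Fin 3) (Fin 3) F).map
    (algebraMap (MvPolynomial (Fin 3 × Fin 3) F)
      (FractionRing (MvPolynomial (Fin 3 × Fin 3) F)))

/-!
A block of bricks has exponential eigen-solutions ("plane waves"). For a row vector `u` put
`v = u A` and `w k = v k / u k`. If the row vector entering the lattice point `x` is
`(∏ k, w k ^ x k) • u`, then every brick passes the wave on to its neighbours, so the block
multiplies the part of the wave in the `j`-th thick space by `w j ^ p`. Cleared of denominators,
this reads `∑ i, u i ^ p * E i * R_ij = v j ^ p * E j`, where the entries of the row vector `E j`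
are products of powers of `u k` and `v k` over the axes `k ≠ j` (`vecMul_cubicBlock`).

Now let `u` be generic, that is, a vector of linear forms in three variables `ξ`. For each `k`
there is one row vector, up to a factor, at which both `u k` and `v k` vanish. In the coordinates
`ξ` given by these three vectors, `u k` and `v k` span the linear forms without `ξ k`
(`baseMatrix`, `pencil_minor`). Hence the entries of `E j` span the space of the products of
binary forms of degree `p - 1`, one in the two variables other than `ξ k` for each `k ≠ j`. It has
a basis of `p ^ 2` distinct monomials, and their coefficients are a basis of the `j`-th thick space
(`exists_coeffMatrix_mul_eq_one`).

In characteristic `p`, the forms `u i ^ p` and `v j ^ p` involve only the `ξ k ^ p`. So the relation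
splits according to the exponents of `ξ` modulo `p`. The reduced exponents have total degree
`2 p - 2` or `p - 2`, with `p (p + 1) / 2` and `p (p - 1) / 2` possibilities; each of them occurs
exactly once in each thick space. In the first case, comparison of coefficients says that `R_ij`
maps basis vectors to basis vectors with the factor `a i j ^ p`. In the second case `E j` carries an
additional factor `ξ j ^ p`. This amounts to the Cremona substitution `ξ k ↦ 1 / ξ k`, and it turns
the matrix `a` into its transpose (`cremona_transpose_mul`), so that the factor is `a j i ^ p`
(`coeffMatrix_vecMul_thickEntry`). This is the decomposition of the block into copies of the brick
of `p`-th powers and of its transpose, and the statements about single blocks are read off from it.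
The only condition on `a` is that `a₁₂ a₂₃ a₃₁ ≠ a₁₃ a₃₂ a₂₁`, the two sides being the
`p`-th roots of the two eigenvalues.
-/

/-! ### Plane waves on the lattice -/

/-- The homogenized plane wave on the `j`-th thick space: at the line `s` it is the product of
the `v k ^ s k * u k ^ (l - 1 - s k)` over the axes `k ≠ j`. -/
def faceWave {K : Type*} [CommRing K] {n : ℕ} (l : ℕ) (u v : Fin (n + 1) → K)
    (j : Fin (n + 1)) (s : Fin n → Fin l) : K :=
  ∏ k : Fin n, v (j.succAbove k) ^ (s k : ℕ) * u (j.succAbove k) ^ (l - 1 - (s k : ℕ))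

/-- The row vector that a plane wave produces once exactly the bricks at the points of `S` have
acted: a line along the axis `j` that carries `m` points of `S` has picked up `m` factors
`v j` in place of factors `u j`. -/
noncomputable def waveState {K : Type*} [CommRing K] {n l : ℕ} (u v : Fin (n + 1) → K)
    (S : Set (Fin (n + 1) → Fin l)) (q : Fin (n + 1) × (Fin n → Fin l)) : K :=
  u q.1 ^ (l - {t : Fin l | q.1.insertNth t q.2 ∈ S}.ncard) *
    v q.1 ^ {t : Fin l | q.1.insertNth t q.2 ∈ S}.ncard * faceWave l u v q.1 q.2

theorem vecMul_brickAt {K : Type*} [CommRing K] {n l : ℕ}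
    (A : Matrix (Fin (n + 1)) (Fin (n + 1)) K) (x : Fin (n + 1) → Fin l)
    (f : Fin (n + 1) × (Fin n → Fin l) → K) (j : Fin (n + 1)) (s : Fin n → Fin l) :
    Matrix.vecMul f (brickAt A x) (j, s) =
      if s = j.removeNth x then ∑ i, f (i, i.removeNth x) * A i j else f (j, s) := by
  simp only [Matrix.vecMul, dotProduct, brickAt, Matrix.of_apply]
  split_ifs with h
  · rw [Fintype.sum_prod_type]
    refine Finset.sum_congr rfl fun i _ => ?_
    rw [Finset.sum_eq_single (i.removeNth x)]
    · simp [h]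
    · intro t _ ht
      have hne : ((i, t) : Fin (n + 1) × (Fin n → Fin l)) ≠ (j, s) := by
        rintro ⟨⟩
        exact ht h
      simp [ht, hne]
    · simp
  · simp [h]

theorem waveState_vecMul_prod {K : Type*} [CommRing K] {n l : ℕ}
    (A : Matrix (Fin (n + 1)) (Fin (n + 1)) K) (u : Fin (n + 1) → K)
    (L : List (Fin (n + 1) → Fin l)) :
    ∀ S : Set (Fin (n + 1) → Fin l), (∀ y, y ∉ S ↔ y ∈ L) → L.Nodup →
      L.Pairwise (fun x y => ¬ y < x) → (∀ y ∈ S, ∀ z, z < y → z ∈ S) →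
      Matrix.vecMul (waveState u (Matrix.vecMul u A) S) (L.map (brickAt A)).prod =
        waveState u (Matrix.vecMul u A) Set.univ := by
  induction L with
  | nil =>
    intro S hS _ _ _
    have : S = Set.univ := by ext y; simpa using hS y
    simp [this]
  | cons x L ih =>
    intro S hS hn hp hl
    rw [List.nodup_cons] at hn
    rw [List.pairwise_cons] at hp
    have hx : x ∉ S := (hS x).2 List.mem_cons_self
    have hlow : ∀ z, z < x → z ∈ S := by
      intro z hz
      by_contra h
      rcases List.mem_cons.1 ((hS z).1 h) with e | e
      · exact hz.ne e
      · exact hp.1 z e hz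
    -- The points of `S` on a line through `x` are exactly those below `x`.
    have hmem : ∀ (j : Fin (n + 1)) (t : Fin l),
        j.insertNth t (j.removeNth x) ∈ S ↔ t < x j := by
      intro j t
      rw [Fin.insertNth_removeNth]
      constructor
      · intro h
        by_contra hlt
        rcases (not_lt.1 hlt).eq_or_lt with e | e
        · rw [← e, Function.update_eq_self] at h
          exact hx h
        · exact hx (hl _ h x (by simpa using e))
      · intro h
        exact hlow _ (by simpa using h)
    have hcard : ∀ j : Fin (n + 1),
        {t : Fin l | j.insertNth t (j.removeNth x) ∈ S}.ncard = x j := by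
      intro j
      have : {t : Fin l | j.insertNth t (j.removeNth x) ∈ S} = ↑(Finset.Iio (x j)) := by
        ext t; simp only [Set.mem_ofPred_eq, hmem, Finset.coe_Iio, Set.mem_Iio]
      rw [this, Set.ncard_coe_finset, Fin.card_Iio]
    have hcard' : ∀ j : Fin (n + 1),
        {t : Fin l | j.insertNth t (j.removeNth x) ∈ insert x S}.ncard = x j + 1 := by
      intro j
      have : {t : Fin l | j.insertNth t (j.removeNth x) ∈ insert x S} =
          ↑(Finset.Iic (x j)) := by
        ext t
        simp only [Set.mem_ofPred_eq, Set.mem_insert_iff, hmem, Finset.coe_Iic, Set.mem_Iic]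
        rw [Fin.insertNth_removeNth, Function.update_eq_self_iff, le_iff_eq_or_lt]
      rw [this, Set.ncard_coe_finset, Fin.card_Iic]
    have hface : ∀ j : Fin (n + 1), (Matrix.vecMul u A j) ^ (x j : ℕ) * u j ^ (l - 1 - (x j : ℕ)) *
        faceWave l u (Matrix.vecMul u A) j (j.removeNth x) =
        ∏ k, (Matrix.vecMul u A k) ^ (x k : ℕ) * u k ^ (l - 1 - (x k : ℕ)) := by
      intro j
      rw [Fin.prod_univ_succAbove _ j]
      rfl
    have step : Matrix.vecMul (waveState u (Matrix.vecMul u A) S) (brickAt A x) =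
        waveState u (Matrix.vecMul u A) (insert x S) := by
      ext ⟨j, s⟩
      rw [vecMul_brickAt]
      split_ifs with h
      · subst h
        have hin : ∀ i, waveState u (Matrix.vecMul u A) S (i, i.removeNth x) =
            u i * ∏ k, (Matrix.vecMul u A k) ^ (x k : ℕ) * u k ^ (l - 1 - (x k : ℕ)) := by
          intro i
          rw [← hface i]
          simp only [waveState, hcard]
          rw [show l - (x i : ℕ) = (l - 1 - (x i : ℕ)) + 1 by omega]
          ring
        have hout : waveState u (Matrix.vecMul u A) (insert x S) (j, j.removeNth x) =
            Matrix.vecMul u A j *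
              ∏ k, (Matrix.vecMul u A k) ^ (x k : ℕ) * u k ^ (l - 1 - (x k : ℕ)) := by
          rw [← hface j]
          simp only [waveState, hcard']
          rw [show l - ((x j : ℕ) + 1) = l - 1 - (x j : ℕ) by omega]
          ring
        rw [hout, Matrix.vecMul, dotProduct, Finset.sum_mul]
        refine Finset.sum_congr rfl fun i _ => ?_
        rw [hin]
        ring
      · have : {t : Fin l | j.insertNth t s ∈ insert x S} =
            {t : Fin l | j.insertNth t s ∈ S} := by
          ext t
          have : j.insertNth t s ≠ x := by
            rintro rfl
            exact h (by simp)
          simp [this]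
        simp only [waveState, this]
    rw [List.map_cons, List.prod_cons, ← Matrix.vecMul_vecMul, step]
    refine ih _ ?_ hn.2 hp.2 ?_
    · intro y
      have := hS y
      by_cases e : y = x
      · subst e; simp [hn.1]
      · simpa [e] using this
    · rintro y (rfl | hy) z hz
      · exact Or.inr (hlow z hz)
      · exact Or.inr (hl y hy z hz)

/-- The block multiplies the part of a plane wave in the `j`-th thick space by
`(v j / u j) ^ l`, where `v = u A`; the identity is cleared of denominators. -/
theorem vecMul_cubicBlock {K : Type*} [CommRing K] {n l : ℕ}
    (A : Matrix (Fin (n + 1)) (Fin (n + 1)) K) (u : Fin (n + 1) → K) :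
    Matrix.vecMul (fun q => u q.1 ^ l * faceWave l u (Matrix.vecMul u A) q.1 q.2)
        (cubicBlock l A) =
      fun q => Matrix.vecMul u A q.1 ^ l * faceWave l u (Matrix.vecMul u A) q.1 q.2 := by
  obtain ⟨h1, h2, h3⟩ := lexOrder_isAdmissible n l
  have := waveState_vecMul_prod A u (lexOrder n l) ∅ (by simpa using h2) h1 h3 (by simp)
  convert this using 1
  · congr 1
    funext q
    simp [waveState]
  · funext q
    simp [waveState, Set.ncard_univ]

theorem cubicBlock_map {K L : Type*} [CommRing K] [CommRing L] (f : K →+* L) {n : ℕ} (l : ℕ)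
    (A : Matrix (Fin (n + 1)) (Fin (n + 1)) K) :
    cubicBlock l (A.map f) = (cubicBlock l A).map f := by
  have h : ∀ x : Fin (n + 1) → Fin l, brickAt (A.map f) x = f.mapMatrix (brickAt A x) := by
    intro x
    ext p q
    simp only [brickAt, Matrix.of_apply, RingHom.mapMatrix_apply, Matrix.map_apply]
    split_ifs <;> simp
  change _ = f.mapMatrix (cubicBlock l A)
  rw [cubicBlock, cubicBlock, map_list_prod, List.map_map]
  congr 2
  funext x
  exact h x

/-! ### Two pencils of linear forms -/

open MvPolynomial in
/-- The linear form with the given coefficients, in three variables. -/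
noncomputable def linForm {K : Type*} [CommRing K] (w : Fin 3 → K) : MvPolynomial (Fin 3) K :=
  ∑ m, C (w m) * X m

/-- The columns are the row vectors `u` with `u k = (u a) k = 0`, for `k = 0, 1, 2`. -/
def baseMatrix {K : Type*} [CommRing K] (a : Matrix (Fin 3) (Fin 3) K) :
    Matrix (Fin 3) (Fin 3) K :=
  !![0, -a 2 1, a 1 2; a 2 0, 0, -a 0 2; -a 1 0, a 0 1, 0]

/-- In a row indexed by `i`, interchange the two entries off the diagonal and clear the diagonal
one. On linear forms `∑ m, c i m * ξ m` without the term `m = i` this is the effect of the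
Cremona substitution `ξ m ↦ 1 / ξ m`, up to a common factor. -/
def cremona {K : Type*} [CommRing K] (c : Matrix (Fin 3) (Fin 3) K) :
    Matrix (Fin 3) (Fin 3) K :=
  Matrix.of fun i n => if i = n + 2 then c i (n + 1) else if i = n + 1 then c i (n + 2) else 0

section Pencils

variable {K : Type*} [CommRing K] (a : Matrix (Fin 3) (Fin 3) K)

theorem det_baseMatrix :
    (baseMatrix a).det = a 0 1 * a 1 2 * a 2 0 - a 0 2 * a 2 1 * a 1 0 := by
  simp [baseMatrix, Matrix.det_fin_three]
  ring

theorem det_cremona_baseMatrix :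
    (cremona (baseMatrix a)).det = a 0 1 * a 1 2 * a 2 0 - a 0 2 * a 2 1 * a 1 0 := by
  simp [cremona, baseMatrix, Matrix.det_fin_three]
  ring

/-- The Cremona substitution turns the action of `a` into that of its transpose. -/
theorem cremona_transpose_mul :
    cremona (a.transpose * baseMatrix a) = a * cremona (baseMatrix a) := by
  ext i j
  fin_cases i <;> fin_cases j <;>
    simp [cremona, baseMatrix, Matrix.mul_apply, Fin.sum_univ_three] <;> ring

theorem baseMatrix_diag (k : Fin 3) : baseMatrix a k k = 0 := by
  fin_cases k <;> simp [baseMatrix]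

theorem transpose_mul_baseMatrix_diag (k : Fin 3) : (a.transpose * baseMatrix a) k k = 0 := by
  fin_cases k <;> simp [baseMatrix, Matrix.mul_apply, Fin.sum_univ_three] <;> ring

/-- The minor of the two forms that belong to `k`: it is the same for all `k`, up to sign. -/
theorem pencil_minor (k : Fin 3) :
    (a.transpose * baseMatrix a) k (k + 1) * baseMatrix a k (k + 2) -
      (a.transpose * baseMatrix a) k (k + 2) * baseMatrix a k (k + 1) =
        a 0 1 * a 1 2 * a 2 0 - a 0 2 * a 2 1 * a 1 0 := by
  fin_cases k <;> simp [baseMatrix, Matrix.mul_apply, Fin.sum_univ_three] <;> ring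

open MvPolynomial in
theorem vecMul_linForm :
    Matrix.vecMul (fun k => linForm (baseMatrix a k)) (a.map C) =
      fun k => linForm ((a.transpose * baseMatrix a) k) := by
  funext j
  simp only [Matrix.vecMul, dotProduct, linForm, Matrix.mul_apply, Matrix.map_apply,
    Matrix.transpose_apply, Fin.sum_univ_three, map_add, map_mul]
  ring

end Pencils

/-- The plane wave in the generic vector of the row space, whose coordinates with respect to the
columns of `baseMatrix a` are the variables. -/
noncomputable def polyWave {K : Type*} [CommRing K] (a : Matrix (Fin 3) (Fin 3) K) (p : ℕ)
    (j : Fin 3) (s : Fin 2 → Fin p) : MvPolynomial (Fin 3) K :=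
  faceWave p (fun k => linForm (baseMatrix a k))
    (fun k => linForm ((a.transpose * baseMatrix a) k)) j s

open MvPolynomial in
theorem degreeOf_linForm_eq_zero {K : Type*} [CommRing K] {w : Fin 3 → K} {k : Fin 3}
    (hw : w k = 0) : degreeOf k (linForm w) = 0 := by
  refine Nat.le_zero.1 ((degreeOf_sum_le _ _ _).trans (Finset.sup_le fun m _ => ?_))
  by_cases h : m = k
  · subst h; simp [hw]
  · exact (degreeOf_C_mul_le _ _ _).trans (degreeOf_X_of_ne (Ne.symm h)).le

open MvPolynomial in
theorem degreeOf_linForm_le_one {K : Type*} [CommRing K] (w : Fin 3 → K) (k : Fin 3) :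
    degreeOf k (linForm w) ≤ 1 := by
  rcases subsingleton_or_nontrivial K with _ | _
  · simp [Subsingleton.elim (linForm w) 0]
  refine (degreeOf_sum_le _ _ _).trans (Finset.sup_le fun m _ => ?_)
  refine (degreeOf_C_mul_le _ _ _).trans ?_
  rw [degreeOf_X]
  split_ifs <;> simp

open MvPolynomial in
/-- In the thick space of the axis `i`, a variable `k ≠ i` occurs only in the binary form that
belongs to the third axis, so its exponents stay below `p`. -/
theorem degreeOf_polyWave_lt {K : Type*} [CommRing K] (a : Matrix (Fin 3) (Fin 3) K) {p : ℕ}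
    (i k : Fin 3) (hk : k ≠ i) (s : Fin 2 → Fin p) : degreeOf k (polyWave a p i s) < p := by
  have hform : ∀ (m : Fin 3) (t : Fin p),
      degreeOf k (linForm ((a.transpose * baseMatrix a) m) ^ (t : ℕ) *
        linForm (baseMatrix a m) ^ (p - 1 - (t : ℕ))) ≤ if m = k then 0 else p - 1 := by
    intro m t
    refine (degreeOf_mul_le _ _ _).trans ((Nat.add_le_add (degreeOf_pow_le _ _ _)
      (degreeOf_pow_le _ _ _)).trans ?_)
    split_ifs with h
    · subst h
      rw [degreeOf_linForm_eq_zero (transpose_mul_baseMatrix_diag a m),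
        degreeOf_linForm_eq_zero (baseMatrix_diag a m)]
      simp
    · have h1 := Nat.mul_le_mul_left (t : ℕ)
        (degreeOf_linForm_le_one ((a.transpose * baseMatrix a) m) k)
      have h2 := Nat.mul_le_mul_left (p - 1 - (t : ℕ))
        (degreeOf_linForm_le_one (baseMatrix a m) k)
      have := t.isLt
      omega
  have hp : 0 < p := (Nat.zero_le _).trans_lt (s 0).isLt
  rw [polyWave, faceWave, Fin.prod_univ_two]
  have h0 := hform (i.succAbove 0) (s 0)
  have h1 := hform (i.succAbove 1) (s 1)
  refine (degreeOf_mul_le _ _ _).trans_lt ?_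
  obtain ⟨r, rfl⟩ := Fin.exists_succAbove_eq hk
  fin_cases r
  · rw [if_pos (by simp)] at h0
    rw [if_neg (by simp)] at h1
    omega
  · rw [if_neg (by simp)] at h0
    rw [if_pos (by simp)] at h1
    omega

/-! ### Exponents -/

/-- The exponents below `p` in the monomial number `τ`. The last one is determined by the other
two, since the total degree is `2 p - 2` or `p - 2`. -/
def baseExponent (p : ℕ) (τ : Fin 2 → Fin p) : Fin 3 → ℕ :=
  ![τ 0, τ 1, if (τ 0 : ℕ) + τ 1 + 2 ≤ p then p - 2 - τ 0 - τ 1 else 2 * p - 2 - τ 0 - τ 1]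

/-- The indices for which `baseExponent p τ` has total degree `p - 2`. -/
def lowDegree (p : ℕ) : Finset (Fin 2 → Fin p) :=
  Finset.univ.filter fun τ => (τ 0 : ℕ) + τ 1 + 2 ≤ p

/-- The exponents of the monomial number `τ` in the thick space of the axis `j`: of total degree
`2 p - 2`, with a `p`-th power of the `j`-th variable added where needed. -/
noncomputable def waveExponent (p : ℕ) (j : Fin 3) (τ : Fin 2 → Fin p) : Fin 3 →₀ ℕ :=
  Finsupp.equivFunOnFinite.symm (baseExponent p τ) +
    if τ ∈ lowDegree p then Finsupp.single j p else 0

theorem baseExponent_lt {p : ℕ} (τ : Fin 2 → Fin p) (k : Fin 3) : baseExponent p τ k < p := by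
  have h0 := (τ 0).isLt
  have h1 := (τ 1).isLt
  fin_cases k
  · exact h0
  · exact h1
  · have h : baseExponent p τ 2 = if (τ 0 : ℕ) + τ 1 + 2 ≤ p then p - 2 - τ 0 - τ 1
        else 2 * p - 2 - τ 0 - τ 1 := rfl
    refine h.trans_lt ?_
    split_ifs <;> omega

theorem sum_waveExponent {p : ℕ} (j : Fin 3) (τ : Fin 2 → Fin p) :
    waveExponent p j τ 0 + waveExponent p j τ 1 + waveExponent p j τ 2 = 2 * p - 2 := by
  have h0 := (τ 0).isLt
  have h1 := (τ 1).isLt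
  by_cases h : (τ 0 : ℕ) + τ 1 + 2 ≤ p <;> fin_cases j <;>
    simp [waveExponent, baseExponent, lowDegree, h] <;> omega

theorem waveExponent_injective (p : ℕ) (j : Fin 3) : Function.Injective (waveExponent p j) := by
  intro τ σ h
  have h0 := DFunLike.congr_fun h 0
  have h1 := DFunLike.congr_fun h 1
  have h2 := DFunLike.congr_fun h 2
  have a0 := (τ 0).isLt
  have a1 := (τ 1).isLt
  have b0 := (σ 0).isLt
  have b1 := (σ 1).isLt
  have key : (τ 0 : ℕ) = σ 0 ∧ (τ 1 : ℕ) = σ 1 := by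
    by_cases hτ : (τ 0 : ℕ) + τ 1 + 2 ≤ p <;> by_cases hσ : (σ 0 : ℕ) + σ 1 + 2 ≤ p <;>
      fin_cases j <;>
      simp [waveExponent, baseExponent, lowDegree, hτ, hσ] at h0 h1 h2 <;> omega
  ext k
  fin_cases k
  · exact key.1
  · exact key.2

theorem card_lowDegree (p : ℕ) : (lowDegree p).card = p * (p - 1) / 2 := by
  have hin : ∀ a : Fin p, (∑ b : Fin p, if (a : ℕ) + b + 2 ≤ p then 1 else 0) =
      p - 1 - (a : ℕ) := by
    intro a
    rw [Fin.sum_univ_eq_sum_range (fun b => if (a : ℕ) + b + 2 ≤ p then 1 else 0) p,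
      ← Finset.card_filter]
    have : (Finset.range p).filter (fun b => (a : ℕ) + b + 2 ≤ p) =
        Finset.range (p - 1 - (a : ℕ)) := by
      ext b
      simp only [Finset.mem_filter, Finset.mem_range]
      omega
    rw [this, Finset.card_range]
  rw [lowDegree, Finset.card_filter, ← (finTwoArrowEquiv (Fin p)).symm.sum_comp,
    Fintype.sum_prod_type]
  simp only [finTwoArrowEquiv_symm_apply, Matrix.cons_val_zero, Matrix.cons_val_one, hin]
  rw [Fin.sum_univ_eq_sum_range (fun a => p - 1 - a) p, Finset.sum_range_reflect (fun a => a) p,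
    Finset.sum_range_id]

theorem card_compl_lowDegree (p : ℕ) : (lowDegree p)ᶜ.card = p * (p + 1) / 2 := by
  rw [Finset.card_compl, card_lowDegree]
  simp only [Fintype.card_pi, Fintype.card_fin, Finset.prod_const, Finset.card_univ]
  rcases p with _ | p
  · simp
  · obtain ⟨m, hm⟩ := (Nat.even_mul_succ_self p).two_dvd
    have e1 : (p + 1) * (p + 1 - 1) = 2 * m := by rw [← hm]; simp [mul_comm]
    have e2 : (p + 1) * (p + 1 + 1) = 2 * (m + (p + 1)) := by
      rw [mul_add 2, ← hm]; ring
    have e3 : (p + 1) ^ 2 = 2 * m + (p + 1) := by rw [← hm]; ring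
    rw [e1, e2, e3]
    omega

/-! ### Bases of the thick spaces -/

open MvPolynomial in
/-- Row `τ` collects the coefficients of the monomial `waveExponent p j τ` in the entries of
`polyWave a p j`. These rows are the new basis of the `j`-th thick space. -/
noncomputable def coeffMatrix {K : Type*} [CommRing K] (a : Matrix (Fin 3) (Fin 3) K) (p : ℕ)
    (j : Fin 3) : Matrix (Fin 2 → Fin p) (Fin 2 → Fin p) K :=
  Matrix.of fun τ s => coeff (waveExponent p j τ) (polyWave a p j s)

/-- A product of `n` factors from the pencil spanned by `u` and `v` is a binary form in `u`, `v`. -/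
theorem pow_mul_pow_mem_span {K R : Type*} [CommRing K] [CommRing R] [Algebra K R] (u v : R)
    {x y : R} (hx : x ∈ Submodule.span K {u, v}) (hy : y ∈ Submodule.span K {u, v})
    {b c n : ℕ} (hn : b + c = n) :
    x ^ b * y ^ c ∈ Submodule.span K
      (Set.range fun t : Fin (n + 1) => v ^ (t : ℕ) * u ^ (n - (t : ℕ))) := by
  have main : ∀ n : ℕ, Submodule.span K {u, v} ^ n ≤ Submodule.span K
      (Set.range fun t : Fin (n + 1) => v ^ (t : ℕ) * u ^ (n - (t : ℕ))) := by
    intro n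
    induction n with
    | zero =>
      rw [pow_zero, Submodule.one_eq_span]
      refine Submodule.span_mono ?_
      rintro _ rfl
      exact ⟨0, by simp⟩
    | succ n ih =>
      rw [pow_succ]
      refine (mul_le_mul_left ih _).trans ?_
      rw [Submodule.span_mul_span, Submodule.span_le]
      rintro _ ⟨_, ⟨t, rfl⟩, w, hw, rfl⟩
      have ht := t.isLt
      refine Submodule.subset_span ?_
      rcases hw with rfl | rfl
      · refine ⟨t.castSucc, ?_⟩
        simp only [Fin.val_castSucc]
        rw [show n + 1 - (t : ℕ) = n - (t : ℕ) + 1 by omega]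
        ring
      · refine ⟨t.succ, ?_⟩
        simp only [Fin.val_succ]
        rw [show n + 1 - ((t : ℕ) + 1) = n - (t : ℕ) by omega]
        ring
  refine main n ?_
  rw [← hn, pow_add]
  exact Submodule.mul_mem_mul (Submodule.pow_mem_pow _ hx b) (Submodule.pow_mem_pow _ hy c)

section Field

variable {K : Type*} [Field K] {a : Matrix (Fin 3) (Fin 3) K}

open MvPolynomial in
theorem X_mem_span_linForm (ha : a 0 1 * a 1 2 * a 2 0 - a 0 2 * a 2 1 * a 1 0 ≠ 0)
    {k m : Fin 3} (hm : m ≠ k) :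
    (X m : MvPolynomial (Fin 3) K) ∈ Submodule.span K
      {linForm (baseMatrix a k), linForm ((a.transpose * baseMatrix a) k)} := by
  have hsum : ∀ w : Fin 3 → K, w k = 0 →
      linForm w = C (w (k + 1)) * X (k + 1) + C (w (k + 2)) * X (k + 2) := by
    intro w hw
    fin_cases k <;> simp_all [linForm, Fin.sum_univ_three]
    ring
  have hu := hsum _ (baseMatrix_diag a k)
  have hv := hsum _ (transpose_mul_baseMatrix_diag a k)
  have hdet := congrArg (C : K → MvPolynomial (Fin 3) K) (pencil_minor a k)
  rw [map_sub C, map_mul C, map_mul C] at hdet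
  set δ := a 0 1 * a 1 2 * a 2 0 - a 0 2 * a 2 1 * a 1 0
  set c := baseMatrix a k
  set d := (a.transpose * baseMatrix a) k
  have hδ : (C δ⁻¹ : MvPolynomial (Fin 3) K) * C δ = 1 := by
    rw [← C_mul, inv_mul_cancel₀ ha, C_1]
  rw [Submodule.mem_span_pair]
  have hcases : m = k + 1 ∨ m = k + 2 := by
    revert hm
    clear * -
    decide +revert
  -- Cramer's rule
  rcases hcases with rfl | rfl
  · refine ⟨-(δ⁻¹ * d (k + 2)), δ⁻¹ * c (k + 2), ?_⟩
    rw [hu, hv, smul_eq_C_mul, smul_eq_C_mul, C_neg, C_mul, C_mul]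
    linear_combination C δ⁻¹ * X (k + 1) * hdet + X (k + 1) * hδ
  · refine ⟨δ⁻¹ * d (k + 1), -(δ⁻¹ * c (k + 1)), ?_⟩
    rw [hu, hv, smul_eq_C_mul, smul_eq_C_mul, C_neg, C_mul, C_mul]
    linear_combination C δ⁻¹ * X (k + 2) * hdet + X (k + 2) * hδ

open MvPolynomial in
theorem monomial_waveExponent_mem_span
    (ha : a 0 1 * a 1 2 * a 2 0 - a 0 2 * a 2 1 * a 1 0 ≠ 0) {p : ℕ} (j : Fin 3)
    (τ : Fin 2 → Fin p) :
    monomial (waveExponent p j τ) (1 : K) ∈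
      Submodule.span K (Set.range (polyWave a p j)) := by
  have hne : ∀ k, k ≠ j → waveExponent p j τ k < p := by
    intro k hk
    have := baseExponent_lt τ k
    simp only [waveExponent, Finsupp.add_apply]
    split_ifs <;> simpa [Finsupp.single_apply, Ne.symm hk]
  have hsum : waveExponent p j τ (j.succAbove 0) + waveExponent p j τ (j.succAbove 1) +
      waveExponent p j τ j = 2 * p - 2 := by
    rw [← sum_waveExponent j τ]
    fin_cases j <;> simp [Fin.succAbove] <;> ring
  have hprod : monomial (waveExponent p j τ) (1 : K) =
      X (j.succAbove 0) ^ waveExponent p j τ (j.succAbove 0) *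
      X (j.succAbove 1) ^ waveExponent p j τ (j.succAbove 1) *
      X j ^ waveExponent p j τ j := by
    rw [monomial_eq, C_1, one_mul, Finsupp.prod_fintype _ _ (by simp), Fin.prod_univ_succAbove _ j,
      Fin.prod_univ_two]
    ring
  have h0 := hne _ (j.succAbove_ne 0)
  have h1 := hne _ (j.succAbove_ne 1)
  have h01 : j.succAbove 0 ≠ j.succAbove 1 := by simp
  rw [hprod]
  generalize waveExponent p j τ (j.succAbove 0) = e0 at *
  generalize waveExponent p j τ (j.succAbove 1) = e1 at *
  have hj : waveExponent p j τ j = (p - 1 - e0) + (p - 1 - e1) := by omega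
  -- Each of the two binary forms takes the variable of the other axis and its share of `X j`.
  have m0 := pow_mul_pow_mem_span _ _ (X_mem_span_linForm ha h01.symm)
    (X_mem_span_linForm ha (j.succAbove_ne 0).symm) (show e1 + (p - 1 - e1) = p - 1 by omega)
  have m1 := pow_mul_pow_mem_span _ _ (X_mem_span_linForm ha h01)
    (X_mem_span_linForm ha (j.succAbove_ne 1).symm) (show e0 + (p - 1 - e0) = p - 1 by omega)
  have hmul := Submodule.mul_mem_mul m0 m1
  rw [Submodule.span_mul_span] at hmul
  rw [hj, pow_add, show ∀ A B C D : MvPolynomial (Fin 3) K, A * B * (C * D) = B * D * (A * C) from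
    fun _ _ _ _ => by ring]
  refine Submodule.span_mono ?_ hmul
  rintro _ ⟨_, ⟨s, rfl⟩, _, ⟨t, rfl⟩, rfl⟩
  refine ⟨![⟨s, by omega⟩, ⟨t, by omega⟩], ?_⟩
  simp only [polyWave, faceWave, Fin.prod_univ_two, Matrix.cons_val_zero, Matrix.cons_val_one]

open MvPolynomial in
theorem exists_coeffMatrix_mul_eq_one
    (ha : a 0 1 * a 1 2 * a 2 0 - a 0 2 * a 2 1 * a 1 0 ≠ 0) (p : ℕ) (j : Fin 3) :
    ∃ N, coeffMatrix a p j * N = 1 := by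
  have h : ∀ τ, ∃ c : (Fin 2 → Fin p) → K,
      ∑ s, c s • polyWave a p j s = monomial (waveExponent p j τ) 1 := fun τ =>
    (Submodule.mem_span_range_iff_exists_fun K).1 (monomial_waveExponent_mem_span ha j τ)
  choose c hc using h
  refine ⟨Matrix.of fun s τ => c τ s, ?_⟩
  ext τ' τ
  have := congrArg (coeff (waveExponent p j τ')) (hc τ)
  rw [coeff_sum, coeff_monomial] at this
  rw [Matrix.mul_apply, Matrix.one_apply]
  simp only [coeffMatrix, Matrix.of_apply]
  simp only [coeff_smul, smul_eq_mul, (waveExponent_injective p j).eq_iff] at this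
  rw [Finset.sum_congr rfl fun s _ => mul_comm _ _, this]
  simp only [eq_comm]

/-! ### Comparison of coefficients -/

open MvPolynomial in
theorem coeff_linForm_pow_mul {p : ℕ} [Fact p.Prime] [CharP K p] (w : Fin 3 → K)
    (f : MvPolynomial (Fin 3) K) (ν : Fin 3 →₀ ℕ) :
    coeff ν (linForm w ^ p * f) =
      ∑ k, if p ≤ ν k then w k ^ p * coeff (ν - Finsupp.single k p) f else 0 := by
  rw [linForm, sum_pow_char, Finset.sum_mul, coeff_sum]
  refine Finset.sum_congr rfl fun k _ => ?_
  have : (C (w k) * X k) ^ p * f = f * monomial (Finsupp.single k p) (w k ^ p) := by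
    rw [mul_pow, ← C_pow, X_pow_eq_monomial, C_mul_monomial, mul_one, mul_comm]
  rw [this, coeff_mul_monomial', mul_comm (coeff _ _)]
  simp only [Finsupp.single_le_iff]

open MvPolynomial in
theorem coeff_polyWave_eq_zero {p : ℕ} {i k : Fin 3} (hk : k ≠ i) (s : Fin 2 → Fin p)
    {ν : Fin 3 →₀ ℕ} (hν : p ≤ ν k) : coeff ν (polyWave a p i s) = 0 := by
  by_contra h
  exact absurd ((monomial_le_degreeOf k (mem_support_iff.2 h)).trans_lt
    (degreeOf_polyWave_lt a i k hk s)) (not_lt.2 hν)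

open MvPolynomial in
/-- For an index of total degree `2 p - 2`, only one `p`-th power of a variable can be split
off. -/
theorem coeff_linForm_pow_mul_polyWave_of_notMem {p : ℕ} [Fact p.Prime] [CharP K p]
    (w : Fin 3 → K) {τ : Fin 2 → Fin p} (hτ : τ ∉ lowDegree p) (l i : Fin 3)
    (s : Fin 2 → Fin p) :
    coeff (Finsupp.equivFunOnFinite.symm (baseExponent p τ) + Finsupp.single l p)
        (linForm w ^ p * polyWave a p i s) = w l ^ p * coeffMatrix a p i τ s := by
  rw [coeff_linForm_pow_mul, Finset.sum_eq_single l]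
  · simp [coeffMatrix, waveExponent, hτ]
  · intro k _ hk
    rw [if_neg]
    simpa [Finsupp.single_apply, Ne.symm hk] using baseExponent_lt τ k
  · simp

open MvPolynomial in
/-- For an index of total degree `p - 2`, the `p`-th powers of two variables can be split off; the
one that remains has to be that of the axis `i`. -/
theorem coeff_linForm_pow_mul_polyWave_of_mem {p : ℕ} [Fact p.Prime] [CharP K p]
    (w : Fin 3 → K) {τ : Fin 2 → Fin p} (hτ : τ ∈ lowDegree p) (n i : Fin 3)
    (s : Fin 2 → Fin p) :
    coeff (Finsupp.equivFunOnFinite.symm (baseExponent p τ) + Finsupp.single (n + 1) p +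
        Finsupp.single (n + 2) p) (linForm w ^ p * polyWave a p i s) =
      (if i = n + 2 then w (n + 1) else if i = n + 1 then w (n + 2) else 0) ^ p *
        coeffMatrix a p i τ s := by
  have hp : p ≠ 0 := (Fact.out : p.Prime).ne_zero
  set μ : Fin 3 →₀ ℕ := Finsupp.equivFunOnFinite.symm (baseExponent p τ) with hμ
  have hz : ∀ k, coeff (μ + Finsupp.single k p) (polyWave a p i s) =
      if i = k then coeffMatrix a p i τ s else 0 := by
    intro k
    split_ifs with h
    · subst h; simp [coeffMatrix, waveExponent, hτ, hμ]
    · exact coeff_polyWave_eq_zero (Ne.symm h) s (by simp)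
  have h1 : μ + Finsupp.single (n + 1) p + Finsupp.single (n + 2) p - Finsupp.single (n + 1) p =
      μ + Finsupp.single (n + 2) p := by
    rw [add_right_comm, add_tsub_cancel_right]
  have h2 : μ + Finsupp.single (n + 1) p + Finsupp.single (n + 2) p - Finsupp.single (n + 2) p =
      μ + Finsupp.single (n + 1) p := add_tsub_cancel_right _ _
  have hn : ¬ p ≤ (μ + Finsupp.single (n + 1) p + Finsupp.single (n + 2) p) n := by
    have : n + 1 ≠ n ∧ n + 2 ≠ n := by clear * -; decide +revert
    simpa [Finsupp.single_apply, this.1, this.2, hμ] using baseExponent_lt τ n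
  have hsum : ∀ g : Fin 3 → K, ∑ k, g k = g n + g (n + 1) + g (n + 2) := by
    intro g
    rw [Fin.sum_univ_three]
    fin_cases n <;> simp <;> ring
  have h12 : n + 1 ≠ n + 2 := by clear * -; decide +revert
  rw [coeff_linForm_pow_mul, hsum, if_neg hn, if_pos (by simp),
    if_pos (by simp), h1, h2, hz, hz]
  by_cases e1 : i = n + 2
  · simp [e1, h12.symm]
  · by_cases e2 : i = n + 1
    · simp [e2, h12]
    · simp [e1, e2, hp]

open MvPolynomial in
/-- The plane wave of `vecMul_cubicBlock` in the generic row vector. -/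
theorem sum_linForm_pow_mul_polyWave (a : Matrix (Fin 3) (Fin 3) K) (p : ℕ) (j : Fin 3)
    (s : Fin 2 → Fin p) :
    ∑ i, ∑ t, C (thickEntry (cubicBlock p a) i j t s) *
        (linForm (baseMatrix a i) ^ p * polyWave a p i t) =
      linForm ((a.transpose * baseMatrix a) j) ^ p * polyWave a p j s := by
  have h := congrFun (vecMul_cubicBlock (l := p) (a.map (C : K →+* MvPolynomial (Fin 3) K))
    fun k => linForm (baseMatrix a k)) (j, s)
  rw [cubicBlock_map, vecMul_linForm] at h
  rw [← polyWave] at h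
  rw [← h, Matrix.vecMul, dotProduct, Fintype.sum_prod_type]
  refine Finset.sum_congr rfl fun i _ => Finset.sum_congr rfl fun t _ => ?_
  rw [mul_comm]
  rfl

/-- If the rows `b i` satisfy the relations obtained by comparing coefficients with an invertible
matrix `x` of coefficients, then `M i j` maps `b i` to `q i j • b j`. -/
theorem vecMul_eq_smul_of_relations {S : Type*} [Fintype S] (M : Fin 3 → Fin 3 → Matrix S S K)
    (b : Fin 3 → S → K) (x q : Matrix (Fin 3) (Fin 3) K) (hx : x.det ≠ 0)
    (h : ∀ l j s, ∑ i, ∑ t, M i j t s * (x i l * b i t) = (q.transpose * x) j l * b j s)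
    (i j : Fin 3) : Matrix.vecMul (b i) (M i j) = q i j • b j := by
  funext s
  have h0 : Matrix.vecMul (fun i => Matrix.vecMul (b i) (M i j) s - q i j * b j s) x = 0 := by
    funext l
    have e1 : ∀ i, Matrix.vecMul (b i) (M i j) s * x i l =
        ∑ t, M i j t s * (x i l * b i t) := by
      intro i
      rw [Matrix.vecMul, dotProduct, Finset.sum_mul]
      exact Finset.sum_congr rfl fun t _ => by ring
    have e2 : ∑ i, q i j * b j s * x i l = (q.transpose * x) j l * b j s := by
      rw [Matrix.mul_apply, Finset.sum_mul]
      exact Finset.sum_congr rfl fun i _ => by rw [Matrix.transpose_apply]; ring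
    rw [Matrix.vecMul, dotProduct]
    simp only [sub_mul, Finset.sum_sub_distrib, e1, e2, h, sub_self, Pi.zero_apply]
  exact sub_eq_zero.1 (congrFun (Matrix.eq_zero_of_vecMul_eq_zero hx h0) i)

open MvPolynomial in
/-- In the new bases the block is a direct sum: the basis vectors with a common index span a copy
of the brick with the entries raised to the power `p`, or of its transpose. -/
theorem coeffMatrix_vecMul_thickEntry {p : ℕ} [Fact p.Prime] [CharP K p]
    (ha : a 0 1 * a 1 2 * a 2 0 - a 0 2 * a 2 1 * a 1 0 ≠ 0) (τ : Fin 2 → Fin p)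
    (i j : Fin 3) :
    Matrix.vecMul (coeffMatrix a p i τ) (thickEntry (cubicBlock p a) i j) =
      (if τ ∈ lowDegree p then (a.map (· ^ p)).transpose else a.map (· ^ p)) i j •
        coeffMatrix a p j τ := by
  have hfrob : ∀ m : Matrix (Fin 3) (Fin 3) K, m.map (· ^ p) = (frobenius K p).mapMatrix m :=
    fun _ => rfl
  have hcoeff : ∀ (ν : Fin 3 →₀ ℕ) (j : Fin 3) (s : Fin 2 → Fin p),
      ∑ i, ∑ t, thickEntry (cubicBlock p a) i j t s *
        coeff ν (linForm (baseMatrix a i) ^ p * polyWave a p i t) =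
      coeff ν (linForm ((a.transpose * baseMatrix a) j) ^ p * polyWave a p j s) := by
    intro ν j s
    rw [← sum_linForm_pow_mul_polyWave]
    simp only [coeff_sum, coeff_C_mul]
  by_cases hτ : τ ∈ lowDegree p
  · rw [if_pos hτ]
    refine vecMul_eq_smul_of_relations (thickEntry (cubicBlock p a)) (fun i => coeffMatrix a p i τ)
      ((cremona (baseMatrix a)).map (· ^ p)) _ ?_ ?_ i j
    · rw [hfrob, ← RingHom.map_det, det_cremona_baseMatrix]
      exact (map_ne_zero _).2 ha
    · intro n j s
      have := hcoeff (Finsupp.equivFunOnFinite.symm (baseExponent p τ) +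
        Finsupp.single (n + 1) p + Finsupp.single (n + 2) p) j s
      simp only [coeff_linForm_pow_mul_polyWave_of_mem _ hτ] at this
      rw [Matrix.transpose_transpose, hfrob, hfrob, ← map_mul, ← cremona_transpose_mul]
      exact this
  · rw [if_neg hτ]
    refine vecMul_eq_smul_of_relations (thickEntry (cubicBlock p a)) (fun i => coeffMatrix a p i τ)
      ((baseMatrix a).map (· ^ p)) _ ?_ ?_ i j
    · rw [hfrob, ← RingHom.map_det, det_baseMatrix]
      exact (map_ne_zero _).2 ha
    · intro l j s
      have := hcoeff (Finsupp.equivFunOnFinite.symm (baseExponent p τ) +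
        Finsupp.single l p) j s
      simp only [coeff_linForm_pow_mul_polyWave_of_notMem _ hτ] at this
      rw [← Matrix.transpose_map, hfrob, hfrob, ← map_mul]
      exact this

end Field

/-! ### Gauge transformations -/

/-- A gauge transformation acts on the blocks `R_ij` one by one. -/
theorem thickEntry_gauge {K : Type*} [CommRing K] {d S : Type*} [Fintype d] [DecidableEq d]
    [Fintype S] (g h : d → Matrix S S K) (R : Matrix (d × S) (d × S) K) (i j : d) :
    thickEntry (gaugeMatrix g * R * gaugeMatrix h) i j = g i * thickEntry R i j * h j := by
  ext s t
  simp [thickEntry, gaugeMatrix, Matrix.mul_apply, Fintype.sum_prod_type,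
    Matrix.blockDiagonal_apply, Finset.sum_ite_eq, Finset.sum_ite_eq']

theorem thickEntry_blockDiagonal {K : Type*} [CommRing K] {d S : Type*} [DecidableEq S]
    (f : S → Matrix d d K) (i j : d) :
    thickEntry (Matrix.blockDiagonal f) i j = Matrix.diagonal fun s => f s i j := by
  ext s t
  simp [thickEntry, Matrix.blockDiagonal_apply, Matrix.diagonal_apply]

theorem thickEntry_injective {K : Type*} {d S : Type*} {R R' : Matrix (d × S) (d × S) K}
    (h : ∀ i j, thickEntry R i j = thickEntry R' i j) : R = R' := by
  ext ⟨i, s⟩ ⟨j, t⟩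
  exact congrFun (congrFun (h i j) s) t

theorem gaugeEquivalent_cubicBlock {K : Type*} [Field K] {a : Matrix (Fin 3) (Fin 3) K} {p : ℕ}
    [Fact p.Prime] [CharP K p] (ha : a 0 1 * a 1 2 * a 2 0 - a 0 2 * a 2 1 * a 1 0 ≠ 0) :
    GaugeEquivalent (cubicBlock p a) (Matrix.blockDiagonal fun τ =>
      if τ ∈ lowDegree p then (a.map (· ^ p)).transpose else a.map (· ^ p)) := by
  choose N hN using exists_coeffMatrix_mul_eq_one ha p
  refine ⟨fun j => ⟨N j, coeffMatrix a p j, mul_eq_one_comm.1 (hN j), hN j⟩,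
    thickEntry_injective fun i j => ?_⟩
  rw [thickEntry_gauge, thickEntry_blockDiagonal]
  change _ = coeffMatrix a p i * _ * N j
  have : coeffMatrix a p i * thickEntry (cubicBlock p a) i j =
      (Matrix.diagonal fun τ => (if τ ∈ lowDegree p then (a.map (· ^ p)).transpose
        else a.map (· ^ p)) i j) * coeffMatrix a p j := by
    ext τ s
    rw [Matrix.diagonal_mul]
    exact congrFun (coeffMatrix_vecMul_thickEntry ha τ i j) s
  rw [this, mul_assoc, hN, mul_one]

theorem thickEntry_of_gauge_eq {K : Type*} [CommRing K] {d S : Type*} [Fintype d] [DecidableEq d]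
    [Fintype S] [DecidableEq S] {R : Matrix (d × S) (d × S) K} {f : S → Matrix d d K}
    (g : d → (Matrix S S K)ˣ)
    (h : Matrix.blockDiagonal f = gaugeMatrix (fun i => ((g i)⁻¹ : (Matrix S S K)ˣ).val) * R *
      gaugeMatrix (fun i => (g i).val)) (i j : d) :
    thickEntry R i j =
      (g i).val * (Matrix.diagonal fun s => f s i j) * ((g j)⁻¹ : (Matrix S S K)ˣ).val := by
  rw [← thickEntry_blockDiagonal, h, thickEntry_gauge]
  simp [mul_assoc]

theorem genericBrick_minor_ne_zero (F : Type*) [Field F] :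
    genericBrick F 0 1 * genericBrick F 1 2 * genericBrick F 2 0 -
      genericBrick F 0 2 * genericBrick F 2 1 * genericBrick F 1 0 ≠ 0 := by
  simp only [genericBrick, Matrix.map_apply, Matrix.mvPolynomialX_apply, ← map_mul, ← map_sub]
  rw [Ne, IsFractionRing.to_map_eq_zero_iff]
  intro h
  -- Evaluate at a permutation matrix.
  have := congrArg (MvPolynomial.eval fun q : Fin 3 × Fin 3 =>
    if q.2 = q.1 + 1 then (1 : F) else 0) h
  simp at this

theorem propositionp (p : ℕ) (hp : p ∈ ({2, 3, 5, 7, 11} : Set ℕ))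
    (F : Type*) [Field F] [CharP F p]
    (a : Matrix (Fin 3) (Fin 3) (FractionRing (MvPolynomial (Fin 3 × Fin 3) F)))
    (ha : a = genericBrick F)
    (R : Matrix (Fin 3 × (Fin 2 → Fin p)) (Fin 3 × (Fin 2 → Fin p))
      (FractionRing (MvPolynomial (Fin 3 × Fin 3) F)))
    (hR : R = cubicBlock p a) :
    -- the diagonal blocks are scalar
    (∀ i : Fin 3, thickEntry R i i = (a i i ^ p) • 1) ∧
    -- the products of opposite off-diagonal blocks commute and are scalar
    (∀ k l : Fin 3, k < l →
      thickEntry R k l * thickEntry R l k = thickEntry R l k * thickEntry R k l ∧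
      thickEntry R k l * thickEntry R l k = (a k l ^ p * a l k ^ p) • 1) ∧
    -- `R₁₂ R₂₃ R₃₁` is diagonalizable, with two eigenvalues of the given multiplicities
    (∃ (Q : (Matrix (Fin 2 → Fin p) (Fin 2 → Fin p)
          (FractionRing (MvPolynomial (Fin 3 × Fin 3) F)))ˣ)
        (T : Finset (Fin 2 → Fin p)),
      T.card = p * (p - 1) / 2 ∧ Tᶜ.card = p * (p + 1) / 2 ∧
      (Q⁻¹).val * (thickEntry R 0 1 * thickEntry R 1 2 * thickEntry R 2 0) * Q.val =
        Matrix.diagonal fun s =>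
          if s ∈ T then a 0 2 ^ p * a 2 1 ^ p * a 1 0 ^ p
          else a 0 1 ^ p * a 1 2 ^ p * a 2 0 ^ p) ∧
    -- in proper bases of the thick spaces, `R` is a direct sum of copies of `rᵀ` and of `r`
    (∃ T : Finset (Fin 2 → Fin p),
      T.card = p * (p - 1) / 2 ∧ Tᶜ.card = p * (p + 1) / 2 ∧
      GaugeEquivalent R (Matrix.blockDiagonal fun s =>
        if s ∈ T then (a.map (· ^ p)).transpose else a.map (· ^ p))) := by
  have hprime : Fact p.Prime := by
    rcases hp with rfl | rfl | rfl | rfl | rfl <;> exact ⟨by norm_num⟩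
  have hchar : CharP (FractionRing (MvPolynomial (Fin 3 × Fin 3) F)) p :=
    charP_of_injective_algebraMap (IsFractionRing.injective (MvPolynomial (Fin 3 × Fin 3) F) _) p
  have hminor := genericBrick_minor_ne_zero F
  rw [← ha] at hminor
  have hgauge := gaugeEquivalent_cubicBlock (p := p) hminor
  rw [← hR] at hgauge
  obtain ⟨g, hg⟩ := id hgauge
  have hent := thickEntry_of_gauge_eq g hg
  have hprod : ∀ k l : Fin 3,
      thickEntry R k l * thickEntry R l k = (a k l ^ p * a l k ^ p) • 1 := by
    intro k l
    have hd : (fun s : Fin 2 → Fin p =>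
        (if s ∈ lowDegree p then (a.map (· ^ p)).transpose else a.map (· ^ p)) k l *
        (if s ∈ lowDegree p then (a.map (· ^ p)).transpose else a.map (· ^ p)) l k) =
        fun _ => a k l ^ p * a l k ^ p := by
      funext s
      split_ifs <;> simp [mul_comm]
    simp only [hent, mul_assoc, Units.inv_mul_cancel_left]
    rw [← mul_assoc (Matrix.diagonal _), Matrix.diagonal_mul_diagonal, hd,
      ← Matrix.smul_one_eq_diagonal]
    simp
  refine ⟨fun i => ?_, fun k l _ => ⟨?_, hprod k l⟩, ⟨g 0, lowDegree p, card_lowDegree p,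
    card_compl_lowDegree p, ?_⟩, ⟨lowDegree p, card_lowDegree p, card_compl_lowDegree p, hgauge⟩⟩
  · have hd : (fun s : Fin 2 → Fin p =>
        (if s ∈ lowDegree p then (a.map (· ^ p)).transpose else a.map (· ^ p)) i i) =
        fun _ => a i i ^ p := by
      funext s
      split_ifs <;> simp
    rw [hent, hd, ← Matrix.smul_one_eq_diagonal]
    simp
  · rw [hprod, hprod, mul_comm]
  · rw [hent, hent, hent]
    simp only [mul_assoc, Units.inv_mul_cancel_left, Units.inv_mul, mul_one,
      Matrix.diagonal_mul_diagonal]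
    congr 1
    funext s
    split_ifs <;> simp
    ring
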